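/- Let $d\ge 1$, let $\Omega\subset\mathbb R^d$ be open, and let $a\in L^2_{\rm loc}(\Omega;\mathbb R)$, $q\in L^2_{\rm loc}(\Omega;\mathbb R)$ with $a,q\ge 0$. Denote by $\|\cdot\|$ the norm of the complex space $L^2(\Omega)$. Multiplication operators in $L^2(\Omega)$ have their maximal domain ${\rm Dom}(m)=\{\psi\in L^2(\Omega): m\psi\in L^2(\Omega)\}$, and $-\Delta+q$ denotes the Dirichlet realization $${\rm Dom}(-\Delta+q)=\{\psi\in W^{1,2}_0(\Omega)\cap{\rm Dom}(q^{1/2}): (-\Delta+q)\psi\in L^2(\Omega)\}.$$ Assume that $a=a_{\rm r}+a_{\rm s}$ with $a_{\rm r}\ge 0$, $a_{\rm r}\in W^{1,\infty}_{\rm loc}(\overline\Omega;\mathbb R)$, $a_{\rm s}\in L^2_{\rm loc}(\Omega;\mathbb R)$, such that for every $\varepsilon>0$ there are constants $M_\nabla,M_{\rm s}>0$ (depending on $\varepsilon$) with $$|\nabla a_{\rm r}|\le \varepsilon a_{\rm r}^{3/2}+M_\nabla(q^{1/2}+1)\quad\text{a.e. in }\Omega,$$ $$\|a_{\rm s}\psi\|\le\varepsilon\big(\|(-\Delta+q)\psi\|+\|a_{\rm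 r}\psi\|\big)+M_{\rm s}\|\psi\|\quad\text{for all }\psi\in{\rm Dom}(a_{\rm r})\cap{\rm Dom}(-\Delta+q).$$ Let $\mathcal W(\Omega)$ be the completion of $C_0^\infty(\Omega)$ with respect to the inner product $\langle\nabla\cdot,\nabla\cdot\rangle+\langle q^{1/2}\cdot,q^{1/2}\cdot\rangle$ (it contains $W^{1,2}_0(\Omega)\cap{\rm Dom}(q^{1/2})$), let $\mathcal H=\mathcal W(\Omega)\times L^2(\Omega)$, and let $G=\overline{G_0}$ be the closure of the operator in $\mathcal H$ given by $$G_0(u_1,u_2)=\big(u_2,\ (\Delta-q)u_1-2a u_2\big),\qquad {\rm Dom}(G_0)=\big({\rm Dom}(-\Delta+q)\cap{\rm Dom}(a)\big)^2.$$ For an operator $A$ in a Hilbert space, a singular sequence of $A$ at $\lambda\in\mathbb C$ is a sequence $\{\psi_n\}\subset{\rm Dom}(A)$ with $\|\psi_n\|=1$, $\psi_n\to 0$ weakly and $(A-\lambda)\psi_n\to0$; $\sigma_{e2}(A)$ is the set of all $\lambda\in\mathbb C$ for which a singular sequence exists. Suppose that for some $\delta>0$ the set $\Omega$ contains the cone $$C_\delta=\{(x_1,x')\in\mathbb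 R\times\mathbb R^{d-1}: x_1>0,\ |x'|<\delta x_1\},\qquad\text{and that}\qquad \lim_{k\to\infty}\ \operatorname*{ess\,sup}_{x\in C_\delta,\ |x|>k} q(x)=0.$$ Then $0\in\sigma_{e2}(G)$. Moreover, there is a singular sequence of $G$ at $0$ of the form $\Phi_n=(\phi_n,0)$ with $\phi_n\in C_0^\infty(\Omega)$ whose supports move to infinity: for every $r$, $\operatorname{supp}\phi_n\subset\{|x|>r\}$ for all sufficiently large $n$. -/

import Mathlib

open MeasureTheory Filter Topology TopologicalSpace
open scoped ENNReal Distributions LineDeriv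

noncomputable section

namespace DampedWave

/-- The Euclidean space `ℝᵈ`. -/
abbrev Rn (d : ℕ) : Type := EuclideanSpace ℝ (Fin d)

/-- Lebesgue measure on the open set `Ω ⊆ ℝᵈ`. -/
abbrev vol {d : ℕ} (Ω : Opens (Rn d)) : Measure (Rn d) := volume.restrict (Ω : Set (Rn d))

/-- The complex Hilbert space `L²(Ω)`. -/
abbrev L2 {d : ℕ} (Ω : Opens (Rn d)) : Type := Lp ℂ 2 (vol Ω)

/-- The complex Hilbert space `L²(Ω)ᵈ` of square integrable vector fields. -/
abbrev L2Vec {d : ℕ} (Ω : Opens (Rn d)) : Type := PiLp 2 (fun _ : Fin d => L2 Ω)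

/-- `f ∈ Lᵖ_loc(Ω)`: `f` is in `Lᵖ(K)` for all compact `K ⊆ Ω`. -/
def MemLpLoc {d : ℕ} {F : Type*} [NormedAddCommGroup F]
    (f : Rn d → F) (p : ℝ≥0∞) (Ω : Opens (Rn d)) : Prop :=
  ∀ K : Set (Rn d), K ⊆ Ω → IsCompact K → MemLp f p (volume.restrict K)

/-- The partial derivative `∂ᵢ φ` of a test function. -/
def pd {d : ℕ} {Ω : Opens (Rn d)} {F : Type*} [NormedAddCommGroup F] [NormedSpace ℝ F]
    (i : Fin d) (φ : 𝓓(Ω, F)) : 𝓓(Ω, F) :=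
  ∂_{(EuclideanSpace.single i (1 : ℝ) : Rn d)} φ

/-- The Laplacian of a test function. -/
def lap {d : ℕ} {Ω : Opens (Rn d)} {F : Type*} [NormedAddCommGroup F] [NormedSpace ℝ F]
    (φ : 𝓓(Ω, F)) : 𝓓(Ω, F) :=
  ∑ i, pd i (pd i φ)

theorem memLp_testFunction {d : ℕ} {Ω : Opens (Rn d)} (φ : 𝓓(Ω, ℂ)) :
    MemLp φ 2 (vol Ω) :=
  (φ.continuous.memLp_of_hasCompactSupport φ.hasCompactSupport).restrict _

/-- The inclusion `C₀^∞(Ω) → L²(Ω)`. -/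
def testL2 {d : ℕ} {Ω : Opens (Rn d)} (φ : 𝓓(Ω, ℂ)) : L2 Ω := (memLp_testFunction φ).toLp φ

/-- The gradient `C₀^∞(Ω) → L²(Ω)ᵈ`. -/
def testGrad {d : ℕ} {Ω : Opens (Rn d)} (φ : 𝓓(Ω, ℂ)) : L2Vec Ω :=
  WithLp.toLp 2 (fun i => testL2 (pd i φ))

theorem testL2_add {d : ℕ} {Ω : Opens (Rn d)} (φ ψ : 𝓓(Ω, ℂ)) :
    testL2 (φ + ψ) = testL2 φ + testL2 ψ := rfl

theorem testL2_smul {d : ℕ} {Ω : Opens (Rn d)} (c : ℂ) (φ : 𝓓(Ω, ℂ)) :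
    testL2 (c • φ) = c • testL2 φ := rfl

theorem testGrad_add {d : ℕ} {Ω : Opens (Rn d)} (φ ψ : 𝓓(Ω, ℂ)) :
    testGrad (φ + ψ) = testGrad φ + testGrad ψ := by
  ext1 i
  simp [testGrad, pd, LineDeriv.lineDerivOp_add, testL2_add]

theorem testGrad_smul {d : ℕ} {Ω : Opens (Rn d)} (c : ℂ) (φ : 𝓓(Ω, ℂ)) :
    testGrad (c • φ) = c • testGrad φ := by
  ext1 i
  simp [testGrad, pd, LineDeriv.lineDerivOp_smul, testL2_smul]

/-- The subspace `{(φ, ∇φ) : φ ∈ C₀^∞(Ω)}` of `L²(Ω) × L²(Ω)ᵈ`. -/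
def testGraph {d : ℕ} (Ω : Opens (Rn d)) : Submodule ℂ (L2 Ω × L2Vec Ω) where
  carrier := {p | ∃ φ : 𝓓(Ω, ℂ), p = (testL2 φ, testGrad φ)}
  add_mem' := by
    rintro _ _ ⟨φ, rfl⟩ ⟨ψ, rfl⟩
    exact ⟨φ + ψ, by rw [testL2_add, testGrad_add]; rfl⟩
  zero_mem' := ⟨(0 : ℂ) • 0, by rw [testL2_smul, testGrad_smul, zero_smul, zero_smul]; rfl⟩
  smul_mem' := by
    rintro c _ ⟨φ, rfl⟩
    exact ⟨c • φ, by rw [testL2_smul, testGrad_smul]; rfl⟩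

/-- The space `W₀^{1,2}(Ω)`, the closure of `C₀^∞(Ω)` in `W^{1,2}(Ω)`, as the space of the pairs
`(u, ∇u)` consisting of a function and its gradient. -/
def sobolevZero {d : ℕ} (Ω : Opens (Rn d)) : Submodule ℂ (L2 Ω × L2Vec Ω) :=
  (testGraph Ω).topologicalClosure

/-- The maximal operator of multiplication by the function `m` in `L²(Ω)`. -/
def mulOp {d : ℕ} (Ω : Opens (Rn d)) (m : Rn d → ℝ) : L2 Ω →ₗ.[ℂ] L2 Ω where
  domain :=
    { carrier := {u | MemLp (fun x => (m x : ℂ) * u x) 2 (vol Ω)}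
      add_mem' := by
        intro u v hu hv
        refine (MemLp.add hu hv).ae_eq ?_
        filter_upwards [Lp.coeFn_add u v] with x hx
        simp only [hx, Pi.add_apply, mul_add]
      zero_mem' := by
        refine (MemLp.zero (ε := ℂ)).ae_eq ?_
        filter_upwards [Lp.coeFn_zero ℂ 2 (vol Ω)] with x hx
        rw [hx]
        simp
      smul_mem' := by
        intro c u hu
        refine (MemLp.const_smul hu c).ae_eq ?_
        filter_upwards [Lp.coeFn_smul c u] with x hx
        simp [hx]
        ring }
  toFun :=
    { toFun := fun u => MemLp.toLp (fun x => (m x : ℂ) * (u : L2 Ω) x) u.2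
      map_add' := by
        intro u v
        rw [← MemLp.toLp_add]
        refine MemLp.toLp_congr _ _ ?_
        filter_upwards [Lp.coeFn_add (u : L2 Ω) (v : L2 Ω)] with x hx
        rw [Submodule.coe_add, hx]
        simp only [Pi.add_apply, mul_add]
      map_smul' := by
        intro c u
        rw [RingHom.id_apply, ← MemLp.toLp_const_smul]
        refine MemLp.toLp_congr _ _ ?_
        filter_upwards [Lp.coeFn_smul c (u : L2 Ω)] with x hx
        simp [hx]
        ring }

/-- `(-Δ + q) u = f` in the sense of distributions on `Ω`, where `q u ∈ L¹_loc(Ω)`. -/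
def DistribEq {d : ℕ} (Ω : Opens (Rn d)) (q : Rn d → ℝ) (u f : L2 Ω) : Prop :=
  MemLpLoc (fun x => (q x : ℂ) * u x) 1 Ω ∧
  ∀ η : 𝓓(Ω, ℝ), - (∫ x, lap η x • u x ∂(vol Ω)) + ∫ x, η x • ((q x : ℂ) * u x) ∂(vol Ω)
    = ∫ x, η x • f x ∂(vol Ω)

theorem integrable_test_smul {d : ℕ} {Ω : Opens (Rn d)} (η : 𝓓(Ω, ℝ)) {g : Rn d → ℂ}
    (hg : MemLpLoc g 1 Ω) : Integrable (fun x => η x • g x) (vol Ω) := by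
  have hK : IntegrableOn g (tsupport η) volume :=
    memLp_one_iff_integrable.1 (hg _ η.tsupport_subset η.hasCompactSupport)
  have h1 : IntegrableOn (fun x => η x • g x) (tsupport η) volume :=
    hK.continuousOn_smul η.continuous.continuousOn η.hasCompactSupport
  have h2 : Integrable (fun x => η x • g x) volume := by
    refine (integrableOn_iff_integrable_of_support_subset ?_).1 h1
    intro x hx
    refine subset_tsupport _ ?_
    simp only [Function.mem_support, ne_eq, smul_eq_zero, not_or] at hx ⊢
    exact hx.1
  exact h2.restrict

theorem memLpLoc_L2 {d : ℕ} {Ω : Opens (Rn d)} (u : L2 Ω) : MemLpLoc u 1 Ω := by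
  intro K hK hKc
  have : IsFiniteMeasure (volume.restrict K) := ⟨by
    rw [Measure.restrict_apply_univ]; exact hKc.measure_lt_top⟩
  exact ((Lp.memLp u).mono_measure (Measure.restrict_mono hK le_rfl)).mono_exponent
    (by norm_num)

theorem memLpLoc_congr {d : ℕ} {Ω : Opens (Rn d)} {g h : Rn d → ℂ}
    (hg : MemLpLoc g 1 Ω) (hgh : g =ᵐ[vol Ω] h) : MemLpLoc h 1 Ω := by
  intro K hK hKc
  exact (hg K hK hKc).ae_eq (ae_restrict_of_ae_restrict_of_subset hK hgh)

/-- The graph of the Dirichlet realization of `-Δ + q` in `L²(Ω)`, with domain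
`{u ∈ W₀^{1,2}(Ω) : q^{1/2} u ∈ L²(Ω), (-Δ + q) u ∈ L²(Ω)}`. -/
def schrodingerGraph {d : ℕ} (Ω : Opens (Rn d)) (q : Rn d → ℝ) : Submodule ℂ (L2 Ω × L2 Ω) where
  carrier := {p | (∃ g, (p.1, g) ∈ sobolevZero Ω) ∧
    p.1 ∈ (mulOp Ω (fun x => √(q x))).domain ∧ DistribEq Ω q p.1 p.2}
  add_mem' := by
    rintro ⟨u, f⟩ ⟨v, h⟩ ⟨⟨g, hg⟩, hu, hq, hD⟩ ⟨⟨g', hg'⟩, hv, hq', hD'⟩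
    have e1 : (fun x => (q x : ℂ) * u x) + (fun x => (q x : ℂ) * v x) =ᵐ[vol Ω]
        fun x => (q x : ℂ) * (u + v : L2 Ω) x := by
      filter_upwards [Lp.coeFn_add u v] with x hx
      simp only [hx, Pi.add_apply, mul_add]
    refine ⟨⟨g + g', add_mem hg hg'⟩, add_mem hu hv, ?_, fun η => ?_⟩
    · exact memLpLoc_congr (fun K hK hKc => (hq K hK hKc).add (hq' K hK hKc)) e1
    · have a1 : ∫ x, lap η x • (u + v : L2 Ω) x ∂(vol Ω) =
          ∫ x, lap η x • u x ∂(vol Ω) + ∫ x, lap η x • v x ∂(vol Ω) := by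
        rw [← integral_add (integrable_test_smul _ (memLpLoc_L2 u))
          (integrable_test_smul _ (memLpLoc_L2 v))]
        refine integral_congr_ae ?_
        filter_upwards [Lp.coeFn_add u v] with x hx
        simp only [hx, Pi.add_apply, smul_add]
      have a2 : ∫ x, η x • (f + h : L2 Ω) x ∂(vol Ω) =
          ∫ x, η x • f x ∂(vol Ω) + ∫ x, η x • h x ∂(vol Ω) := by
        rw [← integral_add (integrable_test_smul _ (memLpLoc_L2 f))
          (integrable_test_smul _ (memLpLoc_L2 h))]
        refine integral_congr_ae ?_
        filter_upwards [Lp.coeFn_add f h] with x hx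
        simp only [hx, Pi.add_apply, smul_add]
      have a3 : ∫ x, η x • ((q x : ℂ) * (u + v : L2 Ω) x) ∂(vol Ω) =
          ∫ x, η x • ((q x : ℂ) * u x) ∂(vol Ω) + ∫ x, η x • ((q x : ℂ) * v x) ∂(vol Ω) := by
        rw [← integral_add (integrable_test_smul _ hq) (integrable_test_smul _ hq')]
        refine integral_congr_ae ?_
        filter_upwards [Lp.coeFn_add u v] with x hx
        simp only [hx, Pi.add_apply, mul_add, smul_add]
      change - (∫ x, lap η x • (u + v : L2 Ω) x ∂(vol Ω))
        + ∫ x, η x • ((q x : ℂ) * (u + v : L2 Ω) x) ∂(vol Ω)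
        = ∫ x, η x • (f + h : L2 Ω) x ∂(vol Ω)
      rw [a1, a2, a3, ← hD η, ← hD' η]
      ring
  zero_mem' := by
    have z := Lp.coeFn_zero ℂ 2 (vol Ω)
    refine ⟨⟨0, zero_mem _⟩, zero_mem _, ?_, fun η => ?_⟩
    · refine memLpLoc_congr (g := 0) (fun K _ _ => MemLp.zero) ?_
      filter_upwards [z] with x hx
      change (0 : ℂ) = (q x : ℂ) * (0 : L2 Ω) x
      rw [hx]
      simp
    · have h1 : ∀ η' : 𝓓(Ω, ℝ), ∫ x, η' x • (0 : L2 Ω) x ∂(vol Ω) = 0 := fun η' =>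
        integral_eq_zero_of_ae (by filter_upwards [z] with x hx; rw [hx]; simp)
      have h2 : ∫ x, η x • ((q x : ℂ) * (0 : L2 Ω) x) ∂(vol Ω) = 0 :=
        integral_eq_zero_of_ae (by filter_upwards [z] with x hx; rw [hx]; simp)
      change - (∫ x, lap η x • (0 : L2 Ω) x ∂(vol Ω))
        + ∫ x, η x • ((q x : ℂ) * (0 : L2 Ω) x) ∂(vol Ω) = ∫ x, η x • (0 : L2 Ω) x ∂(vol Ω)
      rw [h1, h1, h2]
      simp
  smul_mem' := by
    rintro c ⟨u, f⟩ ⟨⟨g, hg⟩, hu, hq, hD⟩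
    refine ⟨⟨c • g, Submodule.smul_mem _ c hg⟩, Submodule.smul_mem _ c hu, ?_, fun η => ?_⟩
    · refine memLpLoc_congr (fun K hK hKc => (hq K hK hKc).const_smul c) ?_
      filter_upwards [Lp.coeFn_smul c u] with x hx
      simp [hx]
      ring
    · have h1 : ∀ (η' : 𝓓(Ω, ℝ)) (w : L2 Ω),
          ∫ x, η' x • (c • w : L2 Ω) x ∂(vol Ω) = c * ∫ x, η' x • w x ∂(vol Ω) := by
        intro η' w
        rw [← integral_const_mul]
        refine integral_congr_ae ?_
        filter_upwards [Lp.coeFn_smul c w] with x hx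
        simp [hx]
        ring
      have h2 : ∫ x, η x • ((q x : ℂ) * (c • u : L2 Ω) x) ∂(vol Ω) =
          c * ∫ x, η x • ((q x : ℂ) * u x) ∂(vol Ω) := by
        rw [← integral_const_mul]
        refine integral_congr_ae ?_
        filter_upwards [Lp.coeFn_smul c u] with x hx
        simp [hx]
        ring
      change - (∫ x, lap η x • (c • u : L2 Ω) x ∂(vol Ω))
        + ∫ x, η x • ((q x : ℂ) * (c • u : L2 Ω) x) ∂(vol Ω)
        = ∫ x, η x • (c • f : L2 Ω) x ∂(vol Ω)
      rw [h1, h1, h2, ← hD η]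
      ring

theorem eq_zero_of_test {d : ℕ} {Ω : Opens (Rn d)} (f : L2 Ω)
    (h : ∀ η : 𝓓(Ω, ℝ), ∫ x, η x • f x ∂(vol Ω) = 0) : f = 0 := by
  have hloc : LocallyIntegrableOn (f : Rn d → ℂ) Ω volume :=
    (locallyIntegrableOn_iff Ω.isOpen.isLocallyClosed).2 fun K hK hKc =>
      memLp_one_iff_integrable.1 (memLpLoc_L2 f K hK hKc)
  have h0 := Ω.isOpen.ae_eq_zero_of_integral_contDiff_smul_eq_zero hloc (fun g g1 g2 g3 => by
    rw [← h ⟨g, g1, g2, g3⟩]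
    symm
    refine setIntegral_eq_integral_of_forall_compl_eq_zero fun x hx => ?_
    change g x • f x = 0
    rw [image_eq_zero_of_notMem_tsupport (fun hx' => hx (g3 hx')), zero_smul])
  rw [Lp.eq_zero_iff_ae_eq_zero]
  exact (ae_restrict_iff' Ω.isOpen.measurableSet).2 h0

/-- `schrodingerGraph Ω q` is the graph of a function, so it is the graph of `schrodinger Ω q`. -/
theorem schrodingerGraph_functional {d : ℕ} (Ω : Opens (Rn d)) (q : Rn d → ℝ) :
    ∀ p ∈ schrodingerGraph Ω q, p.1 = 0 → p.2 = 0 := by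
  rintro ⟨u, f⟩ ⟨-, -, -, hD⟩ hu
  have hu : u = 0 := hu
  subst hu
  refine eq_zero_of_test f fun η => ?_
  rw [← hD η]
  have z := Lp.coeFn_zero ℂ 2 (vol Ω)
  have h1 : ∫ x, lap η x • (0 : L2 Ω) x ∂(vol Ω) = 0 :=
    integral_eq_zero_of_ae (by filter_upwards [z] with x hx; rw [hx]; simp)
  have h2 : ∫ x, η x • ((q x : ℂ) * (0 : L2 Ω) x) ∂(vol Ω) = 0 :=
    integral_eq_zero_of_ae (by filter_upwards [z] with x hx; rw [hx]; simp)
  rw [h1, h2]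
  simp

theorem integral_smul_eq_inner {d : ℕ} {Ω : Opens (Rn d)} {η : Rn d → ℝ}
    (hη : MemLp (fun x => (η x : ℂ)) 2 (vol Ω)) (u : L2 Ω) :
    ∫ x, η x • u x ∂(vol Ω) = inner ℂ (hη.toLp _) u := by
  rw [L2.inner_def]
  refine integral_congr_ae ?_
  filter_upwards [hη.coeFn_toLp] with x hx
  rw [hx]
  simp [mul_comm]

theorem memLp_ofReal {d : ℕ} {Ω : Opens (Rn d)} {η : Rn d → ℝ} (h1 : Continuous η)
    (h2 : HasCompactSupport η) : MemLp (fun x => (η x : ℂ)) 2 (vol Ω) :=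
  ((Complex.continuous_ofReal.comp h1).memLp_of_hasCompactSupport
    (h2.comp_left (g := fun r : ℝ => (r : ℂ)) Complex.ofReal_zero)).restrict _

/-- Functions in `W₀^{1,2}(Ω)`, extended by zero, are weakly differentiable in `ℝᵈ`. -/
theorem sobolevZero_weak {d : ℕ} {Ω : Opens (Rn d)} {u : L2 Ω} {g : L2Vec Ω}
    (h : (u, g) ∈ sobolevZero Ω) {η : Rn d → ℝ} (h1 : ContDiff ℝ 1 η) (h2 : HasCompactSupport η)
    (i : Fin d) :
    ∫ x, (fderiv ℝ η x (EuclideanSpace.single i 1)) • u x ∂(vol Ω)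
      = - ∫ x, η x • g i x ∂(vol Ω) := by
  have m1 : MemLp (fun x => (η x : ℂ)) 2 (vol Ω) := memLp_ofReal h1.continuous h2
  have c' : Continuous fun x => fderiv ℝ η x (EuclideanSpace.single i 1) :=
    (h1.continuous_fderiv one_ne_zero).clm_apply continuous_const
  have s' : HasCompactSupport fun x => fderiv ℝ η x (EuclideanSpace.single i 1) :=
    h2.fderiv_apply (𝕜 := ℝ) _
  have m2 := memLp_ofReal (Ω := Ω) c' s'
  suffices key : ∀ p ∈ sobolevZero Ω,
      inner ℂ (m2.toLp _) p.1 + inner ℂ (m1.toLp _) (p.2 i) = 0 by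
    rw [integral_smul_eq_inner m2, integral_smul_eq_inner m1]
    exact eq_neg_of_add_eq_zero_left (key _ h)
  have hcl : IsClosed {p : L2 Ω × L2Vec Ω |
      inner ℂ (m2.toLp _) p.1 + inner ℂ (m1.toLp _) (p.2 i) = 0} := by
    refine isClosed_eq ?_ continuous_const
    refine (continuous_const.inner continuous_fst).add (continuous_const.inner ?_)
    exact (PiLp.continuous_apply 2 _ i).comp continuous_snd
  refine fun p hp => closure_minimal ?_ hcl hp
  rintro _ ⟨φ, rfl⟩
  change inner ℂ (m2.toLp _) (testL2 φ) + inner ℂ (m1.toLp _) (testL2 (pd i φ)) = 0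
  rw [← integral_smul_eq_inner, ← integral_smul_eq_inner]
  have e : ∀ (ζ : Rn d → ℝ) (θ : 𝓓(Ω, ℂ)),
      ∫ x, ζ x • testL2 θ x ∂(vol Ω) = ∫ x, (ζ x : ℂ) * θ x := by
    intro ζ θ
    rw [← setIntegral_eq_integral_of_forall_compl_eq_zero (s := (Ω : Set (Rn d)))
      (f := fun x => (ζ x : ℂ) * θ x)]
    · refine integral_congr_ae ?_
      filter_upwards [(memLp_testFunction θ).coeFn_toLp] with x hx
      rw [testL2, hx]
      simp
    · intro x hx
      rw [image_eq_zero_of_notMem_tsupport (f := θ) (fun hx' => hx (θ.tsupport_subset hx')),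
        mul_zero]
  have hpd : ∀ x, pd i φ x = fderiv ℝ φ x (EuclideanSpace.single i 1) := fun x => by
    have hd : DifferentiableAt ℝ φ x := (φ.contDiff.differentiable (by simp)).differentiableAt
    rw [pd, TestFunction.lineDerivOp_eq_lineDerivCLM ℝ,
      TestFunction.lineDerivCLM_apply_of_le (𝕜 := ℝ) (n := ⊤) (k := ⊤) (by simp), hd.lineDeriv_eq_fderiv]
  have hη : ∀ x, HasFDerivAt (fun x => (η x : ℂ)) (Complex.ofRealCLM.comp (fderiv ℝ η x)) x :=
    fun x => Complex.ofRealCLM.hasFDerivAt.comp x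
      (h1.differentiable one_ne_zero).differentiableAt.hasFDerivAt
  have cφ : HasCompactSupport (pd i φ) := (pd i φ).hasCompactSupport
  have ibp := integral_mul_fderiv_eq_neg_fderiv_mul_of_integrable (𝕜 := ℂ) (μ := volume)
    (f := fun x => (η x : ℂ)) (g := φ) (v := EuclideanSpace.single i (1 : ℝ))
    (by
      refine Continuous.integrable_of_hasCompactSupport ?_ φ.hasCompactSupport.mul_left
      simp only [(hη _).fderiv]
      exact (Complex.continuous_ofReal.comp c').mul φ.continuous)
    (by
      simp only [← hpd]
      exact ((Complex.continuous_ofReal.comp h1.continuous).mul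
        (pd i φ).continuous).integrable_of_hasCompactSupport cφ.mul_left)
    (((Complex.continuous_ofReal.comp h1.continuous).mul
        φ.continuous).integrable_of_hasCompactSupport φ.hasCompactSupport.mul_left)
    (fun x _ => (hη x).differentiableAt)
    (fun x _ => (φ.contDiff.differentiable (by simp)).differentiableAt)
  rw [e, e]
  simp only [hpd]
  rw [ibp]
  simp only [(hη _).fderiv]
  simp

/-- The gradient of a function in `W₀^{1,2}(Ω)` is unique. -/
theorem sobolevZero_gradient_unique {d : ℕ} {Ω : Opens (Rn d)} {g : L2Vec Ω}
    (h : ((0 : L2 Ω), g) ∈ sobolevZero Ω) : g = 0 := by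
  ext1 i
  refine eq_zero_of_test _ fun η => ?_
  have := sobolevZero_weak h (η.contDiff.of_le (by simp)) η.hasCompactSupport i
  rw [eq_comm, neg_eq_iff_eq_neg] at this
  rw [this, neg_eq_zero]
  refine integral_eq_zero_of_ae ?_
  filter_upwards [Lp.coeFn_zero ℂ 2 (vol Ω)] with x hx
  rw [hx]
  simp

/-- A function in `W₀^{1,2}(Ω)` with zero gradient vanishes. -/
theorem sobolevZero_eq_zero {d : ℕ} [NeZero d] {Ω : Opens (Rn d)} {u : L2 Ω}
    (h : (u, (0 : L2Vec Ω)) ∈ sobolevZero Ω) : u = 0 := by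
  refine eq_zero_of_test u fun η => ?_
  set e : Rn d := EuclideanSpace.single 0 1 with he
  have ηc : ContDiff ℝ 1 η := η.contDiff.of_le (by simp)
  have tc : ∀ y : Rn d, ContDiff ℝ 1 fun x => η (x - y) := fun y =>
    ηc.comp (contDiff_id.sub contDiff_const)
  have ts : ∀ y : Rn d, HasCompactSupport fun x => η (x - y) := fun y =>
    η.hasCompactSupport.comp_homeomorph (Homeomorph.subRight y)
  have tm : ∀ y : Rn d, MemLp (fun x => ((η (x - y) : ℝ) : ℂ)) 2 (vol Ω) := fun y =>
    memLp_ofReal (tc y).continuous (ts y)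
  have e1 : ‖e‖ = 1 := by simp [he]
  obtain ⟨r, hr⟩ := η.hasCompactSupport.isBounded.subset_closedBall (0 : Rn d)
  have integrable_of_inner : ∀ {ζ : Rn d → ℝ} (_ : MemLp (fun x => ((ζ x : ℝ) : ℂ)) 2 (vol Ω)),
      Integrable (fun x => ζ x • u x) (vol Ω) := by
    intro ζ hζ
    refine (hζ.integrable_mul (Lp.memLp u)).congr (Eventually.of_forall fun x => ?_)
    simp
  -- the integral against translates of `η` does not depend on the translation
  obtain ⟨F, hF⟩ : ∃ F : ℝ → ℂ, F = fun s => ∫ x, η (x - s • e) • u x ∂(vol Ω) := ⟨_, rfl⟩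
  have dF : ∀ s, HasDerivAt F 0 s := by
    intro s
    have fd : ∀ (t : ℝ) (x : Rn d),
        fderiv ℝ (fun x => η (x - t • e)) x e = fderiv ℝ η (x - t • e) e := fun t x => by
      rw [fderiv_comp_sub]
    have hz : ∫ x, (- fderiv ℝ η (x - s • e) e) • u x ∂(vol Ω) = 0 := by
      have := sobolevZero_weak h (tc (s • e)) (ts (s • e)) 0
      simp only [neg_smul, integral_neg, ← fd]
      rw [this, neg_neg]
      refine integral_eq_zero_of_ae ?_
      filter_upwards [Lp.coeFn_zero ℂ 2 (vol Ω)] with x hx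
      change _ • (0 : L2 Ω) x = _
      rw [hx]
      simp
    obtain ⟨B, hB⟩ := (ηc.continuous_fderiv one_ne_zero).bounded_above_of_compact_support
      (η.hasCompactSupport.fderiv (𝕜 := ℝ))
    have uint : IntegrableOn (fun x => B * ‖u x‖) (Metric.closedBall 0 (r + (|s| + 1))) (vol Ω) := by
      have : IsFiniteMeasure ((vol Ω).restrict (Metric.closedBall 0 (r + (|s| + 1)))) := ⟨by
        rw [Measure.restrict_apply_univ]
        exact (Measure.restrict_apply_le _ _).trans_lt (isCompact_closedBall _ _).measure_lt_top⟩
      exact (((Lp.memLp u).restrict _).integrable (by norm_num)).norm.const_mul B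
    have key := hasDerivAt_integral_of_dominated_loc_of_deriv_le (μ := vol Ω) (𝕜 := ℝ)
      (F := fun t x => η (x - t • e) • u x) (x₀ := s) (s := Metric.ball s 1)
      (F' := fun t x => (- fderiv ℝ η (x - t • e) e) • u x)
      (bound := (Metric.closedBall (0 : Rn d) (r + (|s| + 1))).indicator fun x => B * ‖u x‖)
      (Metric.ball_mem_nhds _ one_pos)
      (Eventually.of_forall fun t => ((tc (t • e)).continuous.aestronglyMeasurable).smul
        (Lp.aestronglyMeasurable u))
      (integrable_of_inner (tm (s • e)))
      (((((ηc.continuous_fderiv one_ne_zero).comp (continuous_id.sub continuous_const)).clm_apply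
        continuous_const).neg.aestronglyMeasurable).smul (Lp.aestronglyMeasurable u))
      (by
        refine Eventually.of_forall fun x t ht => ?_
        by_cases hx : x ∈ Metric.closedBall (0 : Rn d) (r + (|s| + 1))
        · rw [Set.indicator_of_mem hx, norm_smul, norm_neg]
          refine mul_le_mul_of_nonneg_right ?_ (norm_nonneg _)
          refine (ContinuousLinearMap.le_opNorm _ _).trans ?_
          rw [e1, mul_one]
          exact hB _
        · rw [Set.indicator_of_notMem hx]
          have : x - t • e ∉ tsupport (fderiv ℝ η) := by
            intro hmem
            have h1 := mem_closedBall_zero_iff.1 (hr (tsupport_fderiv_subset ℝ hmem))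
            apply hx
            rw [mem_closedBall_zero_iff]
            have h2 : ‖x‖ ≤ ‖x - t • e‖ + ‖t • e‖ := by
              simpa using norm_add_le (x - t • e) (t • e)
            rw [norm_smul, e1, mul_one, Real.norm_eq_abs] at h2
            have h3 : |t| ≤ |s| + 1 := by
              have := abs_sub_abs_le_abs_sub t s
              rw [Metric.mem_ball, Real.dist_eq] at ht
              linarith
            linarith
          rw [image_eq_zero_of_notMem_tsupport this]
          simp)
      ((integrable_indicator_iff Metric.isClosed_closedBall.measurableSet).2 uint)
      (by
        refine Eventually.of_forall fun x t _ => ?_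
        refine HasDerivAt.smul_const ?_ _
        have h1 : HasDerivAt (fun t : ℝ => x - t • e) (- e) t := by
          simpa using ((hasDerivAt_id t).smul_const e).const_sub x
        have h2 := ((ηc.differentiable one_ne_zero) (x - t • e)).hasFDerivAt.comp_hasDerivAt t h1
        rw [map_neg] at h2
        exact h2)
    have := key.2
    rw [hz] at this
    rw [hF]
    exact this
  have const : ∀ s, F s = F 0 :=
    fun s => is_const_of_deriv_eq_zero (fun s => (dF s).differentiableAt) (fun s => (dF s).deriv) s 0
  have goal0 : ∫ x, η x • u x ∂(vol Ω) = F 0 := by simp [hF]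
  rw [goal0, ← norm_le_zero_iff]
  -- compare with a test function close to `u`
  obtain ⟨C, hC⟩ : ∃ C : ℝ, ∀ y : Rn d, ‖(tm y).toLp _‖ ≤ C := by
    have m0 : MemLp (fun x => ((η x : ℝ) : ℂ)) 2 volume :=
      (Complex.continuous_ofReal.comp η.continuous).memLp_of_hasCompactSupport
        (η.hasCompactSupport.comp_left (g := fun r : ℝ => (r : ℂ)) Complex.ofReal_zero)
    refine ⟨(eLpNorm (fun x => ((η x : ℝ) : ℂ)) 2 volume).toReal, fun y => ?_⟩
    rw [Lp.norm_toLp]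
    refine ENNReal.toReal_mono m0.eLpNorm_ne_top ?_
    refine (eLpNorm_mono_measure _ Measure.restrict_le_self).trans ?_
    exact (eLpNorm_comp_measurePreserving m0.aestronglyMeasurable
      (measurePreserving_sub_right volume y)).le
  have C0 : 0 ≤ C := (norm_nonneg _).trans (hC 0)
  refine le_of_forall_pos_le_add fun ε hε => ?_
  obtain ⟨_, ⟨φ, rfl⟩, hφ⟩ := Metric.mem_closure_iff.1 h (ε / (C + 1)) (by positivity)
  have hφ' : ‖u - testL2 φ‖ < ε / (C + 1) := by
    rw [← dist_eq_norm]
    exact (le_max_left _ _).trans_lt hφ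
  obtain ⟨s, hs⟩ : ∃ s : ℝ, ∀ x, η (x - s • e) • φ x = 0 := by
    obtain ⟨r', hr'⟩ := φ.hasCompactSupport.isBounded.subset_closedBall (0 : Rn d)
    refine ⟨|r| + |r'| + 1, fun x => ?_⟩
    by_contra hne
    rw [smul_eq_zero, not_or] at hne
    have h1 := mem_closedBall_zero_iff.1 (hr (subset_tsupport _ hne.1))
    have h2 := mem_closedBall_zero_iff.1 (hr' (subset_tsupport _ hne.2))
    have h3 : ‖(|r| + |r'| + 1) • e‖ ≤ ‖x‖ + ‖x - (|r| + |r'| + 1) • e‖ := by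
      simpa using norm_sub_le x (x - (|r| + |r'| + 1) • e)
    rw [norm_smul, e1, mul_one, Real.norm_eq_abs, abs_of_pos (by positivity)] at h3
    have := le_abs_self r
    have := le_abs_self r'
    linarith
  rw [← const s, hF]
  change ‖∫ x, η (x - s • e) • u x ∂(vol Ω)‖ ≤ _
  rw [integral_smul_eq_inner (tm (s • e))]
  have i0 : inner ℂ ((tm (s • e)).toLp _) (testL2 φ) = 0 := by
    rw [← integral_smul_eq_inner (tm (s • e))]
    refine integral_eq_zero_of_ae ?_
    filter_upwards [(memLp_testFunction φ).coeFn_toLp] with x hx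
    rw [testL2, hx]
    exact hs x
  have : inner ℂ ((tm (s • e)).toLp _) u = inner ℂ ((tm (s • e)).toLp _) (u - testL2 φ) := by
    rw [inner_sub_right, i0, sub_zero]
  rw [this, zero_add]
  calc _ ≤ ‖(tm (s • e)).toLp _‖ * ‖u - testL2 φ‖ := norm_inner_le_norm _ _
    _ ≤ C * (ε / (C + 1)) := mul_le_mul (hC _) hφ'.le (norm_nonneg _) C0
    _ ≤ ε := by
      rw [mul_div_assoc', div_le_iff₀ (by positivity)]
      nlinarith

/-- The Dirichlet realization of `-Δ + q` in `L²(Ω)`. -/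
def schrodinger {d : ℕ} (Ω : Opens (Rn d)) (q : Rn d → ℝ) : L2 Ω →ₗ.[ℂ] L2 Ω :=
  (schrodingerGraph Ω q).toLinearPMap

/-- `g` is the weak gradient in `Ω` of the real function `f`. -/
def IsWeakGradient {d : ℕ} (Ω : Opens (Rn d)) (f : Rn d → ℝ) (g : Rn d → Rn d) : Prop :=
  MemLpLoc f 1 Ω ∧ MemLpLoc g 1 Ω ∧
  ∀ (η : 𝓓(Ω, ℝ)) (i : Fin d),
    ∫ x, f x * pd i η x ∂(vol Ω) = - ∫ x, g x i * η x ∂(vol Ω)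

/-- `f` is essentially bounded on all bounded subsets of `Ω`, i.e. `f ∈ L^∞_loc(closure Ω)`. -/
def MemLinftyLocClosure {d : ℕ} {F : Type*} [NormedAddCommGroup F]
    (Ω : Opens (Rn d)) (f : Rn d → F) : Prop :=
  ∀ r : ℝ, MemLp f ∞ (volume.restrict ((Ω : Set (Rn d)) ∩ Metric.ball 0 r))

/-- The regularity assumptions on the damping `a` and the potential `q`. -/
structure Regularity {d : ℕ} (Ω : Opens (Rn d)) (a q : Rn d → ℝ) : Prop where
  a_loc : MemLpLoc a 2 Ω
  q_loc : MemLpLoc q 1 Ω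
  a_nonneg : ∀ᵐ x ∂(vol Ω), 0 ≤ a x
  q_nonneg : ∀ᵐ x ∂(vol Ω), 0 ≤ q x
  decomposition : ∃ (ar as : Rn d → ℝ) (Dar : Rn d → Rn d),
    (∀ᵐ x ∂(vol Ω), a x = ar x + as x) ∧
    (∀ᵐ x ∂(vol Ω), 0 ≤ ar x) ∧
    IsWeakGradient Ω ar Dar ∧ MemLinftyLocClosure Ω ar ∧ MemLinftyLocClosure Ω Dar ∧
    MemLpLoc as 2 Ω ∧
    (∀ ε : ℝ, 0 < ε → ∃ M : ℝ, 0 < M ∧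
      ∀ᵐ x ∂(vol Ω), ‖Dar x‖ ≤ ε * (ar x) ^ (3 / 2 : ℝ) + M * (√(q x) + 1)) ∧
    (∀ ε : ℝ, 0 < ε → ∃ M : ℝ, 0 < M ∧
      ∀ (ψ : L2 Ω) (h₁ : ψ ∈ (mulOp Ω ar).domain) (h₂ : ψ ∈ (schrodinger Ω q).domain),
        ∃ h₃ : ψ ∈ (mulOp Ω as).domain,
          ‖mulOp Ω as ⟨ψ, h₃⟩‖ ≤
            ε * (‖schrodinger Ω q ⟨ψ, h₂⟩‖ + ‖mulOp Ω ar ⟨ψ, h₁⟩‖) + M * ‖ψ‖)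

/-- The subspace `{(∇φ, q^{1/2} φ) : φ ∈ C₀^∞(Ω)}` of the Hilbert space `L²(Ω)ᵈ × L²(Ω)`; by
`φ ↦ (∇φ, q^{1/2} φ)` it is an isometric copy of `C₀^∞(Ω)` with the inner product
`⟨∇·, ∇·⟩ + ⟨q^{1/2}·, q^{1/2}·⟩`, if `q ∈ L¹_loc(Ω)`. -/
def formCore {d : ℕ} (Ω : Opens (Rn d)) (q : Rn d → ℝ) :
    Submodule ℂ (WithLp 2 (L2Vec Ω × L2 Ω)) where
  carrier := {w | ∃ φ : 𝓓(Ω, ℂ), w.fst = testGrad φ ∧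
    w.snd =ᵐ[vol Ω] fun x => (√(q x) : ℂ) * φ x}
  add_mem' := by
    rintro w w' ⟨φ, h1, h2⟩ ⟨ψ, h3, h4⟩
    refine ⟨φ + ψ, by rw [testGrad_add, ← h1, ← h3]; rfl, ?_⟩
    filter_upwards [h2, h4, Lp.coeFn_add w.snd w'.snd] with x hx hx' hxx
    rw [WithLp.add_snd, hxx]
    simp [hx, hx', mul_add]
  zero_mem' := by
    refine ⟨0, ?_, ?_⟩
    · have := testGrad_smul (0 : ℂ) (0 : 𝓓(Ω, ℂ))
      rw [zero_smul, zero_smul] at this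
      rw [this]; rfl
    · filter_upwards [Lp.coeFn_zero ℂ 2 (vol Ω)] with x hx
      rw [WithLp.zero_snd, hx]
      simp
  smul_mem' := by
    rintro c w ⟨φ, h1, h2⟩
    refine ⟨c • φ, by rw [testGrad_smul, ← h1]; rfl, ?_⟩
    filter_upwards [h2, Lp.coeFn_smul c w.snd] with x hx hxx
    rw [WithLp.smul_snd, hxx]
    simp [hx]
    ring

/-- The completion of `C₀^∞(Ω)` with respect to `⟨∇·, ∇·⟩ + ⟨q^{1/2}·, q^{1/2}·⟩`, realized as the
closure of the isometric copy `formCore Ω q` of `C₀^∞(Ω)` in the Hilbert space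
`L²(Ω)ᵈ × L²(Ω)`. -/
abbrev FormSpace {d : ℕ} (Ω : Opens (Rn d)) (q : Rn d → ℝ) : Type :=
  (formCore Ω q).topologicalClosure

/-- The product Hilbert space of the form space and `L²(Ω)`. -/
abbrev StateSpace {d : ℕ} (Ω : Opens (Rn d)) (q : Rn d → ℝ) : Type :=
  WithLp 2 (FormSpace Ω q × L2 Ω)

/-- The element `w` of the completion is the function `u ∈ W₀^{1,2}(Ω) ∩ Dom(q^{1/2})`; under the
realization of the completion, `u` corresponds to `(∇u, q^{1/2} u)`. -/
def Represents {d : ℕ} (Ω : Opens (Rn d)) (q : Rn d → ℝ) (u : L2 Ω) (w : FormSpace Ω q) : Prop :=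
  (u, (w : WithLp 2 (L2Vec Ω × L2 Ω)).fst) ∈ sobolevZero Ω ∧
  (w : WithLp 2 (L2Vec Ω × L2 Ω)).snd =ᵐ[vol Ω] fun x => (√(q x) : ℂ) * u x

theorem Represents.add {d : ℕ} {Ω : Opens (Rn d)} {q : Rn d → ℝ} {u v : L2 Ω}
    {w z : FormSpace Ω q} (hu : Represents Ω q u w) (hv : Represents Ω q v z) :
    Represents Ω q (u + v) (w + z) := by
  refine ⟨add_mem hu.1 hv.1, ?_⟩
  filter_upwards [hu.2, hv.2, Lp.coeFn_add u v,
    Lp.coeFn_add (w : WithLp 2 (L2Vec Ω × L2 Ω)).snd (z : WithLp 2 (L2Vec Ω × L2 Ω)).snd]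
    with x h1 h2 h3 h4
  rw [Submodule.coe_add, WithLp.add_snd, h4, h3, Pi.add_apply, Pi.add_apply, h1, h2, mul_add]

theorem Represents.smul {d : ℕ} {Ω : Opens (Rn d)} {q : Rn d → ℝ} {u : L2 Ω}
    {w : FormSpace Ω q} (c : ℂ) (hu : Represents Ω q u w) :
    Represents Ω q (c • u) (c • w) := by
  refine ⟨Submodule.smul_mem _ c hu.1, ?_⟩
  filter_upwards [hu.2, Lp.coeFn_smul c u,
    Lp.coeFn_smul c (w : WithLp 2 (L2Vec Ω × L2 Ω)).snd] with x h1 h3 h4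
  rw [Submodule.coe_smul, WithLp.smul_snd, h4, h3, Pi.smul_apply, Pi.smul_apply, h1, smul_eq_mul,
    smul_eq_mul]
  ring

theorem represents_zero {d : ℕ} (Ω : Opens (Rn d)) (q : Rn d → ℝ) : Represents Ω q 0 0 := by
  refine ⟨zero_mem _, ?_⟩
  filter_upwards [Lp.coeFn_zero ℂ 2 (vol Ω)] with x hx
  rw [ZeroMemClass.coe_zero, WithLp.zero_snd, hx]
  simp

/-- The graph of the operator matrix `G₀ (u₁, u₂) = (u₂, (Δ - q) u₁ - 2 a u₂)` with domain
`(Dom(-Δ + q) ∩ Dom(a))²` in the state space. -/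
def G0Graph {d : ℕ} (Ω : Opens (Rn d)) (a q : Rn d → ℝ) :
    Submodule ℂ (StateSpace Ω q × StateSpace Ω q) where
  carrier := {p | ∃ u₁ u₂ : ((schrodinger Ω q).domain ⊓ (mulOp Ω a).domain : Submodule ℂ (L2 Ω)),
    Represents Ω q u₁ p.1.fst ∧ p.1.snd = u₂ ∧
    Represents Ω q u₂ p.2.fst ∧
    p.2.snd = - schrodinger Ω q ⟨u₁, u₁.2.1⟩ - (2 : ℂ) • mulOp Ω a ⟨u₂, u₂.2.2⟩}
  add_mem' := by
    rintro p p' ⟨u₁, u₂, h1, h2, h3, h4⟩ ⟨v₁, v₂, h1', h2', h3', h4'⟩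
    refine ⟨u₁ + v₁, u₂ + v₂, h1.add h1', ?_, h3.add h3', ?_⟩
    · change p.1.snd + p'.1.snd = _
      rw [h2, h2']; rfl
    · have e1 := (schrodinger Ω q).map_add ⟨u₁, u₁.2.1⟩ ⟨v₁, v₁.2.1⟩
      have e2 := (mulOp Ω a).map_add ⟨u₂, u₂.2.2⟩ ⟨v₂, v₂.2.2⟩
      change p.2.snd + p'.2.snd = - schrodinger Ω q (⟨u₁, u₁.2.1⟩ + ⟨v₁, v₁.2.1⟩)
        - (2 : ℂ) • mulOp Ω a (⟨u₂, u₂.2.2⟩ + ⟨v₂, v₂.2.2⟩)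
      rw [e1, e2, h4, h4', smul_add]
      abel
  zero_mem' := by
    refine ⟨0, 0, represents_zero Ω q, rfl, represents_zero Ω q, ?_⟩
    have e1 := (schrodinger Ω q).map_zero
    have e2 := (mulOp Ω a).map_zero
    change (0 : L2 Ω) = - schrodinger Ω q 0 - (2 : ℂ) • mulOp Ω a 0
    rw [e1, e2]
    simp
  smul_mem' := by
    rintro c p ⟨u₁, u₂, h1, h2, h3, h4⟩
    refine ⟨c • u₁, c • u₂, h1.smul c, ?_, h3.smul c, ?_⟩
    · change c • p.1.snd = _
      rw [h2]; rfl
    · have e1 := (schrodinger Ω q).map_smul c ⟨u₁, u₁.2.1⟩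
      have e2 := (mulOp Ω a).map_smul c ⟨u₂, u₂.2.2⟩
      change c • p.2.snd = - schrodinger Ω q (c • ⟨u₁, u₁.2.1⟩)
        - (2 : ℂ) • mulOp Ω a (c • ⟨u₂, u₂.2.2⟩)
      rw [e1, e2, h4, smul_sub, smul_neg, smul_comm]

/-- `G0Graph Ω a q` is the graph of a function, so it is the graph of `G0 Ω a q`. -/
theorem G0Graph_functional {d : ℕ} [NeZero d] (Ω : Opens (Rn d)) (a q : Rn d → ℝ) :
    ∀ p ∈ G0Graph Ω a q, p.1 = 0 → p.2 = 0 := by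
  rintro ⟨x, y⟩ ⟨⟨u₁, m₁⟩, ⟨u₂, m₂⟩, h1, h2, h3, h4⟩ hx
  have hx : x = 0 := hx
  subst hx
  obtain rfl : u₁ = 0 := sobolevZero_eq_zero h1.1
  obtain rfl : 0 = u₂ := h2
  have hs : y.snd = 0 := by
    have e1 := (schrodinger Ω q).map_zero
    have e2 := (mulOp Ω a).map_zero
    change y.snd = - schrodinger Ω q 0 - (2 : ℂ) • mulOp Ω a 0 at h4
    rw [h4, e1, e2]
    simp
  have hf : y.fst = 0 := by
    have g0 := sobolevZero_gradient_unique h3.1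
    have s0 : (y.fst : WithLp 2 (L2Vec Ω × L2 Ω)).snd = 0 := by
      rw [Lp.eq_zero_iff_ae_eq_zero]
      filter_upwards [h3.2, Lp.coeFn_zero ℂ 2 (vol Ω)] with x hx hz
      change _ = (√(q x) : ℂ) * (0 : L2 Ω) x at hx
      rw [hx, hz]
      simp
    apply Subtype.ext
    apply WithLp.ofLp_injective
    exact Prod.ext g0 s0
  apply WithLp.ofLp_injective
  exact Prod.ext hf hs

/-- The operator `G₀` in the state space. -/
def G0 {d : ℕ} (Ω : Opens (Rn d)) (a q : Rn d → ℝ) : StateSpace Ω q →ₗ.[ℂ] StateSpace Ω q :=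
  (G0Graph Ω a q).toLinearPMap

/-- The generator `G` of the damped wave equation: the closure of `G₀`. -/
def generator {d : ℕ} (Ω : Opens (Rn d)) (a q : Rn d → ℝ) :
    StateSpace Ω q →ₗ.[ℂ] StateSpace Ω q :=
  (G0 Ω a q).closure

/-- `ψ` is a singular (Weyl) sequence of the operator `A` at the point `z`. -/
def IsSingularSequence {H : Type*} [NormedAddCommGroup H] [InnerProductSpace ℂ H]
    (A : H →ₗ.[ℂ] H) (z : ℂ) (ψ : ℕ → A.domain) : Prop :=
  (∀ n, ‖(ψ n : H)‖ = 1) ∧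
  (∀ w : H, Tendsto (fun n => inner ℂ w (ψ n : H)) atTop (𝓝 0)) ∧
  Tendsto (fun n => A (ψ n) - z • (ψ n : H)) atTop (𝓝 0)

/-- The essential spectrum `σ_{e2}(A)` defined by singular sequences. -/
def essentialSpectrum2 {H : Type*} [NormedAddCommGroup H] [InnerProductSpace ℂ H]
    (A : H →ₗ.[ℂ] H) : Set ℂ :=
  {z | ∃ ψ : ℕ → A.domain, IsSingularSequence A z ψ}

/-- The cone `{(x₁, x') ∈ ℝ × ℝᵈ⁻¹ : x₁ > 0, |x'| < δ x₁}`. -/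
def cone (d : ℕ) [NeZero d] (δ : ℝ) : Set (Rn d) :=
  {x | 0 < x 0 ∧ √(∑ i ∈ Finset.univ.erase 0, (x i) ^ 2) < δ * x 0}

end DampedWave

end

noncomputable section

namespace DampedWave

/-! On a pair `(φ, 0)` the damping term vanishes and `G (φ, 0) = (0, -(-Δ + q) φ)`. So it suffices
to find test functions `φₙ` of energy norm one, `‖∇φₙ‖² + ‖q^{1/2} φₙ‖² = 1`, with `‖(-Δ + q) φₙ‖ →
0` and supports leaving every ball; weak convergence to zero then follows from boundedness and the
escaping supports.

The cone contains balls at distance of order `R` from the origin with radius proportional to `R`. A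
fixed bump `β` is dilated to such a ball. The gradient norm scales like `R⁻¹ R^{d/2}` and the norm
of the Laplacian like `R⁻² R^{d/2}`, so after division by the energy norm, which is at least the
gradient norm, the Laplacian is `O(R⁻¹)`. For the potential, `‖q φ‖ ≤ (sup q)^{1/2} ‖q^{1/2} φ‖`,
and the last factor is at most the energy norm. Hence `q → 0` along the cone is enough, without any
rate.

The construction is carried out in `exists_test_far`, from `norm_testGrad_of_scaling`,
`norm_testL2_lap_of_scaling`, `closedBall_subset_cone` and `norm_schrodingerTest_le`. The action of
`G` is `mem_generator_of_test`, and weak convergence is `tendsto_inner_testForm`. -/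

/-! ### Derivatives of test functions and their products with locally integrable functions. -/

theorem pd_apply {d : ℕ} {Ω : Opens (Rn d)} {F : Type*} [NormedAddCommGroup F] [NormedSpace ℝ F]
    (i : Fin d) (φ : 𝓓(Ω, F)) (x : Rn d) :
    pd i φ x = fderiv ℝ φ x (EuclideanSpace.single i 1) := by
  have hd : DifferentiableAt ℝ φ x := (φ.contDiff.differentiable (by simp)).differentiableAt
  rw [pd, TestFunction.lineDerivOp_eq_lineDerivCLM ℝ,
    TestFunction.lineDerivCLM_apply_of_le (𝕜 := ℝ) (n := ⊤) (k := ⊤) (by simp),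
    hd.lineDeriv_eq_fderiv]

theorem lap_apply {d : ℕ} {Ω : Opens (Rn d)} {F : Type*} [NormedAddCommGroup F] [NormedSpace ℝ F]
    (φ : 𝓓(Ω, F)) (x : Rn d) : lap φ x = ∑ i, pd i (pd i φ) x := by
  simp [lap]

theorem coeFn_testL2 {d : ℕ} {Ω : Opens (Rn d)} (φ : 𝓓(Ω, ℂ)) : testL2 φ =ᵐ[vol Ω] φ :=
  (memLp_testFunction φ).coeFn_toLp

theorem tsupport_pd_subset {d : ℕ} {Ω : Opens (Rn d)} (i : Fin d) (φ : 𝓓(Ω, ℂ)) :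
    tsupport (pd i φ) ⊆ tsupport φ := by
  have h : (pd i φ : Rn d → ℂ) = fun x => fderiv ℝ φ x (EuclideanSpace.single i 1) :=
    funext (pd_apply i φ)
  rw [h]
  exact tsupport_fderiv_apply_subset ℝ _

theorem testL2_lap {d : ℕ} {Ω : Opens (Rn d)} (φ : 𝓓(Ω, ℂ)) :
    testL2 (lap φ) = ∑ i, testL2 (pd i (pd i φ)) := by
  let T : 𝓓(Ω, ℂ) →+ L2 Ω := AddMonoidHom.mk' testL2 testL2_add
  exact map_sum T _ _

/-- Multiplication by a test function maps `L²_loc(Ω)` to `L²(Ω)`. -/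
theorem MemLpLoc.memLp_mul_test {d : ℕ} {Ω : Opens (Rn d)} {m : Rn d → ℝ}
    (hm : MemLpLoc m 2 Ω) (φ : 𝓓(Ω, ℂ)) : MemLp (fun x => (m x : ℂ) * φ x) 2 (vol Ω) := by
  obtain ⟨C, hC⟩ := φ.hasCompactSupport.exists_bound_of_continuous φ.continuous
  have h1 := hm _ φ.tsupport_subset φ.hasCompactSupport
  have h2 : MemLp (fun x => (m x : ℂ) * φ x) 2 (volume.restrict (tsupport φ)) := by
    refine MemLp.of_le_mul (c := C) h1
      ((Complex.continuous_ofReal.comp_aestronglyMeasurable h1.aestronglyMeasurable).mul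
        φ.continuous.aestronglyMeasurable) (Eventually.of_forall fun x => ?_)
    rw [norm_mul, Complex.norm_real, mul_comm]
    exact mul_le_mul_of_nonneg_right (hC x) (norm_nonneg _)
  -- The product vanishes off `tsupport φ`, so square integrability on this compact set gives it on
  -- all of `ℝᵈ`.
  have h3 : MemLp ((tsupport φ).indicator fun x => (m x : ℂ) * φ x) 2 volume :=
    (memLp_indicator_iff_restrict (isClosed_tsupport φ).measurableSet).2 h2
  rw [Set.indicator_eq_self.2] at h3
  · exact h3.restrict _
  · intro x hx
    exact subset_tsupport _ (right_ne_zero_of_mul hx)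

theorem MemLpLoc.sqrt {d : ℕ} {Ω : Opens (Rn d)} {m : Rn d → ℝ} (hm : MemLpLoc m 1 Ω) :
    MemLpLoc (fun x => √(m x)) 2 Ω := by
  intro K hK hKc
  have h1 := hm K hK hKc
  refine (memLp_two_iff_integrable_sq
    (Real.continuous_sqrt.comp_aestronglyMeasurable h1.aestronglyMeasurable)).2 ?_
  -- Since `√` is zero on negative reals, `√(m x) ^ 2` is the positive part of `m x`, whatever its
  -- sign.
  refine (memLp_one_iff_integrable.1 h1).pos_part.congr (Eventually.of_forall fun x => ?_)
  rcases le_total 0 (m x) with h | h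
  · simp [h, Real.sq_sqrt]
  · simp [h, Real.sqrt_eq_zero_of_nonpos]

/-! ### Test functions in the domain of `-Δ + q` and in the form space. -/

/-- The square integrable function `(-Δ + q) φ` for a test function `φ`. -/
def schrodingerTest {d : ℕ} {Ω : Opens (Rn d)} {q : Rn d → ℝ} (hq : MemLpLoc q 2 Ω)
    (φ : 𝓓(Ω, ℂ)) : L2 Ω :=
  -testL2 (lap φ) + (hq.memLp_mul_test φ).toLp _

theorem testL2_mem_sobolevZero {d : ℕ} {Ω : Opens (Rn d)} (φ : 𝓓(Ω, ℂ)) :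
    (testL2 φ, testGrad φ) ∈ sobolevZero Ω :=
  subset_closure ⟨φ, rfl⟩

theorem testL2_mem_mulOp {d : ℕ} {Ω : Opens (Rn d)} {m : Rn d → ℝ} (hm : MemLpLoc m 2 Ω)
    (φ : 𝓓(Ω, ℂ)) : testL2 φ ∈ (mulOp Ω m).domain := by
  refine (hm.memLp_mul_test φ).ae_eq ?_
  filter_upwards [coeFn_testL2 φ] with x hx
  rw [hx]

/-- Two integrations by parts in each coordinate, whose signs cancel. Each is an instance of
`sobolevZero_weak`. -/
theorem integral_lap_smul_testL2 {d : ℕ} {Ω : Opens (Rn d)} (η : 𝓓(Ω, ℝ)) (φ : 𝓓(Ω, ℂ)) :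
    ∫ x, lap η x • testL2 φ x ∂(vol Ω) = ∫ x, η x • testL2 (lap φ) x ∂(vol Ω) := by
  have h1 : ∀ i (ζ : 𝓓(Ω, ℝ)) (θ : 𝓓(Ω, ℂ)), ∫ x, pd i ζ x • testL2 θ x ∂(vol Ω)
      = -∫ x, ζ x • testL2 (pd i θ) x ∂(vol Ω) := by
    intro i ζ θ
    have := sobolevZero_weak (testL2_mem_sobolevZero θ) (ζ.contDiff.of_le (by simp))
      ζ.hasCompactSupport i
    simp only [← pd_apply] at this
    exact this
  have h2 : ∀ x, (lap η x : ℝ) • testL2 φ x = ∑ i, pd i (pd i η) x • testL2 φ x := fun x => by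
    rw [lap_apply, Finset.sum_smul]
  have h3 : (fun x => η x • testL2 (lap φ) x) =ᵐ[vol Ω]
      fun x => ∑ i, η x • testL2 (pd i (pd i φ)) x := by
    have : ∀ᵐ x ∂(vol Ω), ∀ i, testL2 (pd i (pd i φ)) x = pd i (pd i φ) x :=
      ae_all_iff.2 fun i => coeFn_testL2 _
    filter_upwards [coeFn_testL2 (lap φ), this] with x hx hx'
    simp only [hx, hx', lap_apply, Finset.smul_sum]
  rw [integral_congr_ae h3, integral_congr_ae (Eventually.of_forall h2),
    integral_finsetSum _ fun i _ => integrable_test_smul _ (memLpLoc_L2 _),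
    integral_finsetSum _ fun i _ => integrable_test_smul _ (memLpLoc_L2 _)]
  refine Finset.sum_congr rfl fun i _ => ?_
  rw [h1, h1, neg_neg]

/-- Local square integrability of `q` puts `q φ` in `L²(Ω)`, so the distribution `(-Δ + q) φ` is a
function in `L²(Ω)`; the distributional identity is then Green's formula `integral_lap_smul_testL2`.
-/
theorem testL2_mem_schrodingerGraph {d : ℕ} {Ω : Opens (Rn d)} {q : Rn d → ℝ}
    (hq1 : MemLpLoc q 1 Ω) (hq : MemLpLoc q 2 Ω) (φ : 𝓓(Ω, ℂ)) :
    (testL2 φ, schrodingerTest hq φ) ∈ schrodingerGraph Ω q := by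
  set Q : L2 Ω := (hq.memLp_mul_test φ).toLp _ with hQ
  have e : (Q : Rn d → ℂ) =ᵐ[vol Ω] fun x => (q x : ℂ) * testL2 φ x := by
    filter_upwards [coeFn_testL2 φ, (hq.memLp_mul_test φ).coeFn_toLp] with x hx hx'
    rw [hQ, hx', hx]
  refine ⟨⟨_, testL2_mem_sobolevZero φ⟩, testL2_mem_mulOp hq1.sqrt φ,
    memLpLoc_congr (memLpLoc_L2 Q) e, fun η => ?_⟩
  have h1 : (fun x => η x • schrodingerTest hq φ x) =ᵐ[vol Ω]
      fun x => -(η x • testL2 (lap φ) x) + η x • ((q x : ℂ) * testL2 φ x) := by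
    filter_upwards [Lp.coeFn_add (-testL2 (lap φ)) Q, Lp.coeFn_neg (testL2 (lap φ)), e]
      with x hx hx' hx''
    rw [schrodingerTest, ← hQ, hx, Pi.add_apply, hx', hx'', Pi.neg_apply, smul_add, smul_neg]
  have h2 := integral_add (integrable_test_smul η (memLpLoc_L2 (testL2 (lap φ)))).neg
    (integrable_test_smul η (memLpLoc_congr (memLpLoc_L2 Q) e))
  simp only [Pi.neg_apply, integral_neg] at h2
  rw [integral_congr_ae h1, h2, integral_lap_smul_testL2]

/-- Together with `testForm_smul`, this permits dividing a test function by its energy norm. -/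
theorem schrodingerTest_smul {d : ℕ} {Ω : Opens (Rn d)} {q : Rn d → ℝ} (hq : MemLpLoc q 2 Ω)
    (c : ℂ) (φ : 𝓓(Ω, ℂ)) : schrodingerTest hq (c • φ) = c • schrodingerTest hq φ := by
  have h1 : testL2 (lap (c • φ)) = c • testL2 (lap φ) := by
    rw [testL2_lap, testL2_lap, Finset.smul_sum]
    simp only [pd, LineDeriv.lineDerivOp_smul, testL2_smul]
  have h2 : (hq.memLp_mul_test (c • φ)).toLp _ = c • (hq.memLp_mul_test φ).toLp _ := by
    rw [← MemLp.toLp_const_smul]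
    refine MemLp.toLp_congr _ _ (Eventually.of_forall fun x => ?_)
    exact mul_left_comm _ _ _
  rw [schrodingerTest, schrodingerTest, h1, h2, smul_add, smul_neg]

/-- The element of the form space given by a test function. -/
def testForm {d : ℕ} {Ω : Opens (Rn d)} {q : Rn d → ℝ} (hq : MemLpLoc q 1 Ω)
    (φ : 𝓓(Ω, ℂ)) : FormSpace Ω q :=
  ⟨WithLp.toLp 2 (testGrad φ, (hq.sqrt.memLp_mul_test φ).toLp _),
    subset_closure ⟨φ, rfl, (hq.sqrt.memLp_mul_test φ).coeFn_toLp⟩⟩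

theorem represents_testForm {d : ℕ} {Ω : Opens (Rn d)} {q : Rn d → ℝ} (hq : MemLpLoc q 1 Ω)
    (φ : 𝓓(Ω, ℂ)) : Represents Ω q (testL2 φ) (testForm hq φ) := by
  refine ⟨testL2_mem_sobolevZero φ, ?_⟩
  filter_upwards [(hq.sqrt.memLp_mul_test φ).coeFn_toLp, coeFn_testL2 φ] with x hx hx'
  rw [hx']
  exact hx

theorem testForm_smul {d : ℕ} {Ω : Opens (Rn d)} {q : Rn d → ℝ} (hq : MemLpLoc q 1 Ω)
    (c : ℂ) (φ : 𝓓(Ω, ℂ)) : testForm hq (c • φ) = c • testForm hq φ := by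
  have h2 : (hq.sqrt.memLp_mul_test (c • φ)).toLp _ = c • (hq.sqrt.memLp_mul_test φ).toLp _ := by
    rw [← MemLp.toLp_const_smul]
    refine MemLp.toLp_congr _ _ (Eventually.of_forall fun x => ?_)
    exact mul_left_comm _ _ _
  apply Subtype.ext
  apply WithLp.ofLp_injective
  exact Prod.ext (testGrad_smul c φ) h2

/-- Dropping either summand shows that the energy norm dominates both `‖∇φ‖` and `‖q^{1/2} φ‖`; it
is used in this way below. -/
theorem norm_sq_testForm {d : ℕ} {Ω : Opens (Rn d)} {q : Rn d → ℝ} (hq : MemLpLoc q 1 Ω)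
    (φ : 𝓓(Ω, ℂ)) : ‖testForm hq φ‖ ^ 2
      = ‖testGrad φ‖ ^ 2 + ‖(hq.sqrt.memLp_mul_test φ).toLp _‖ ^ 2 :=
  WithLp.prod_norm_sq_eq_of_L2 _

/-! ### The generator on pairs `(φ, 0)`. -/

/-- The damping acts only on the second component, which is zero here. It enters only through `φ ∈
Dom(a)`, which holds because `a` is locally square integrable. -/
theorem mem_G0Graph_of_test {d : ℕ} {Ω : Opens (Rn d)} {a q : Rn d → ℝ}
    (ha : MemLpLoc a 2 Ω) (hq1 : MemLpLoc q 1 Ω) (hq : MemLpLoc q 2 Ω) (φ : 𝓓(Ω, ℂ)) :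
    ((WithLp.toLp 2 (testForm hq1 φ, 0), WithLp.toLp 2 (0, -schrodingerTest hq φ)) :
      StateSpace Ω q × StateSpace Ω q) ∈ G0Graph Ω a q := by
  have hg := testL2_mem_schrodingerGraph hq1 hq φ
  rw [← Submodule.toLinearPMap_graph_eq _ (schrodingerGraph_functional Ω q)] at hg
  obtain ⟨⟨y, hd⟩, hy, hy'⟩ := (LinearPMap.mem_graph_iff _).1 hg
  obtain rfl : y = testL2 φ := hy
  refine ⟨⟨testL2 φ, hd, testL2_mem_mulOp ha φ⟩, 0, represents_testForm hq1 φ, rfl,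
    represents_zero Ω q, ?_⟩
  have e1 : schrodinger Ω q ⟨testL2 φ, hd⟩ = schrodingerTest hq φ := hy'
  have e2 := (mulOp Ω a).map_zero
  change -schrodingerTest hq φ = -schrodinger Ω q ⟨testL2 φ, hd⟩ - (2 : ℂ) • mulOp Ω a 0
  rw [e1, e2, smul_zero, sub_zero]

theorem mem_generator_of_test {d : ℕ} [NeZero d] {Ω : Opens (Rn d)} {a q : Rn d → ℝ}
    (ha : MemLpLoc a 2 Ω) (hq1 : MemLpLoc q 1 Ω) (hq : MemLpLoc q 2 Ω) (φ : 𝓓(Ω, ℂ)) :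
    ∃ Φ : (generator Ω a q).domain,
      (Φ : StateSpace Ω q) = WithLp.toLp 2 (testForm hq1 φ, 0) ∧
      generator Ω a q Φ = WithLp.toLp 2 (0, -schrodingerTest hq φ) := by
  have hg := mem_G0Graph_of_test ha hq1 hq φ
  rw [← Submodule.toLinearPMap_graph_eq _ (G0Graph_functional Ω a q)] at hg
  -- `closure` of a map that is not closable is the map itself, so `le_closure` requires no
  -- closability of `G0`.
  exact (LinearPMap.mem_graph_iff _).1 (LinearPMap.le_graph_of_le (G0 Ω a q).le_closure hg)

/-! ### Weak convergence from escaping supports. -/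

/-- A bounded sequence in `L²(Ω)` whose supports move to infinity converges weakly to zero. -/
theorem tendsto_inner_of_support {d : ℕ} {Ω : Opens (Rn d)} {f : ℕ → L2 Ω} {C : ℝ}
    (hC : ∀ n, ‖f n‖ ≤ C)
    (hf : ∀ r : ℝ, ∀ᶠ n in atTop, ∀ᵐ x ∂(vol Ω), ‖x‖ ≤ r → f n x = 0) (w : L2 Ω) :
    Tendsto (fun n => inner ℂ w (f n)) atTop (𝓝 0) := by
  rw [Metric.tendsto_nhds]
  intro ε hε
  have C0 : 0 ≤ C := (norm_nonneg _).trans (hC 0)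
  -- `w` is replaced by a compactly supported `g`, which is eventually orthogonal to `f n`. The
  -- tolerance makes the error at most `ε / (C + 1) / 2 * C < ε`, with `C + 1` to allow `C = 0`.
  obtain ⟨g, hg1, hg2, -, hg4⟩ := (Lp.memLp w).exists_hasCompactSupport_eLpNorm_sub_le
    (by norm_num) (ε := ENNReal.ofReal (ε / (C + 1) / 2)) (by simp; positivity)
  obtain ⟨r, hr⟩ := hg1.isBounded.subset_closedBall (0 : Rn d)
  have hw : ‖w - hg4.toLp g‖ ≤ ε / (C + 1) / 2 := by
    rw [Lp.norm_def]
    refine ENNReal.toReal_le_of_le_ofReal (by positivity) (le_trans (le_of_eq ?_) hg2)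
    refine eLpNorm_congr_ae ?_
    filter_upwards [Lp.coeFn_sub w (hg4.toLp g), hg4.coeFn_toLp] with x hx hx'
    rw [hx, Pi.sub_apply, Pi.sub_apply, hx']
  filter_upwards [hf r] with n hn
  have h0 : inner ℂ (hg4.toLp g) (f n) = 0 := by
    rw [L2.inner_def]
    refine integral_eq_zero_of_ae ?_
    filter_upwards [hn, hg4.coeFn_toLp] with x hx hx'
    by_cases hxr : ‖x‖ ≤ r
    · rw [hx hxr]; simp
    · rw [hx', image_eq_zero_of_notMem_tsupport
        (fun h => hxr (mem_closedBall_zero_iff.1 (hr h)))]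
      simp
  have h1 : inner ℂ w (f n) = inner ℂ (w - hg4.toLp g) (f n) := by
    rw [inner_sub_left, h0, sub_zero]
  rw [dist_zero_right, h1]
  calc _ ≤ ‖w - hg4.toLp g‖ * ‖f n‖ := norm_inner_le_norm _ _
    _ ≤ ε / (C + 1) / 2 * C := mul_le_mul hw (hC n) (norm_nonneg _) (by positivity)
    _ < ε := by
      have : ε / (C + 1) / 2 * C = ε * (C / (2 * (C + 1))) := by field_simp
      rw [this]
      refine mul_lt_of_lt_one_right hε ?_
      rw [div_lt_one (by positivity)]
      linarith

/-! ### Norms of dilated test functions. -/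

/-- Integrating over all of `ℝᵈ` removes `Ω` from the norm, so that test functions on different open
sets can be compared by a change of variables. -/
theorem norm_testL2_sq {d : ℕ} {Ω : Opens (Rn d)} (φ : 𝓓(Ω, ℂ)) :
    ‖testL2 φ‖ ^ 2 = ∫ x, ‖φ x‖ ^ 2 := by
  have h1 : ((‖testL2 φ‖ ^ 2 : ℝ) : ℂ) = ((∫ x, ‖φ x‖ ^ 2 ∂(vol Ω) : ℝ) : ℂ) := by
    rw [← integral_complex_ofReal, Complex.ofReal_pow]
    refine (inner_self_eq_norm_sq_to_K (𝕜 := ℂ) (testL2 φ)).symm.trans ?_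
    rw [L2.inner_def]
    refine integral_congr_ae ?_
    filter_upwards [coeFn_testL2 φ] with x hx
    rw [hx, inner_self_eq_norm_sq_to_K]
    simp
  rw [Complex.ofReal_injective h1]
  refine setIntegral_eq_integral_of_forall_compl_eq_zero fun x hx => ?_
  rw [image_eq_zero_of_notMem_tsupport (f := φ) (fun hx' => hx (φ.tsupport_subset hx'))]
  simp

/-- The factor `√(R ^ d)` is the square root of the Jacobian. The prefactor `s` lets the same lemma
serve the derivatives, which pick up powers of `R⁻¹`. -/
theorem norm_testL2_of_scaling {d : ℕ} {Ω Ω' : Opens (Rn d)} {ψ : 𝓓(Ω, ℂ)} {β : 𝓓(Ω', ℂ)}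
    {s R : ℝ} {c : Rn d} (hs : 0 ≤ s) (hR : 0 < R)
    (h : ∀ x, ψ x = s * β (R⁻¹ • (x - c))) :
    ‖testL2 ψ‖ = s * √(R ^ d) * ‖testL2 β‖ := by
  rw [← sq_eq_sq₀ (norm_nonneg _) (by positivity), mul_pow, mul_pow, norm_testL2_sq,
    norm_testL2_sq, Real.sq_sqrt (by positivity)]
  simp only [h, norm_mul, mul_pow, Complex.norm_real, Real.norm_eq_abs, sq_abs]
  rw [integral_const_mul, mul_assoc,
    integral_sub_right_eq_self (fun x => ‖β (R⁻¹ • x)‖ ^ 2) c,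
    Measure.integral_comp_inv_smul_of_nonneg volume (fun x => ‖β x‖ ^ 2) hR.le]
  simp

/-- The conclusion has the shape of the hypothesis `h` with `s * R⁻¹` for `s`, so it can be iterated
to reach second derivatives. -/
theorem pd_of_scaling {d : ℕ} {Ω Ω' : Opens (Rn d)} {ψ : 𝓓(Ω, ℂ)} {β : 𝓓(Ω', ℂ)}
    {s R : ℝ} {c : Rn d} (h : ∀ x, ψ x = s * β (R⁻¹ • (x - c))) (i : Fin d) (x : Rn d) :
    pd i ψ x = (s * R⁻¹ : ℝ) * pd i β (R⁻¹ • (x - c)) := by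
  have hβ := (β.contDiff.differentiable (by simp) (R⁻¹ • (x - c))).hasFDerivAt
  have hA : HasFDerivAt (fun x : Rn d => R⁻¹ • (x - c)) (R⁻¹ • ContinuousLinearMap.id ℝ (Rn d)) x :=
    ((hasFDerivAt_id x).sub_const c).const_smul R⁻¹
  have := ((hβ.comp x hA).const_mul (s : ℂ)).fderiv
  rw [pd_apply, pd_apply, show (ψ : Rn d → ℂ) = fun x => s * β (R⁻¹ • (x - c)) from funext h]
  erw [this]
  simp
  ring

theorem norm_testGrad_of_scaling {d : ℕ} {Ω Ω' : Opens (Rn d)} {ψ : 𝓓(Ω, ℂ)} {β : 𝓓(Ω', ℂ)}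
    {R : ℝ} {c : Rn d} (hR : 0 < R) (h : ∀ x, ψ x = β (R⁻¹ • (x - c))) :
    ‖testGrad ψ‖ = R⁻¹ * √(R ^ d) * ‖testGrad β‖ := by
  rw [← sq_eq_sq₀ (norm_nonneg _) (by positivity), mul_pow, PiLp.norm_sq_eq_of_L2,
    PiLp.norm_sq_eq_of_L2, Finset.mul_sum]
  refine Finset.sum_congr rfl fun i _ => ?_
  have h' : ∀ x, ψ x = (1 : ℝ) * β (R⁻¹ • (x - c)) := fun x => by simp [h]
  have := norm_testL2_of_scaling (by positivity) hR (pd_of_scaling h' i)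
  change ‖testL2 (pd i ψ)‖ ^ 2 = _ * ‖testL2 (pd i β)‖ ^ 2
  rw [this]
  ring

theorem norm_testL2_lap_of_scaling {d : ℕ} {Ω Ω' : Opens (Rn d)} {ψ : 𝓓(Ω, ℂ)} {β : 𝓓(Ω', ℂ)}
    {R : ℝ} {c : Rn d} (hR : 0 < R) (h : ∀ x, ψ x = β (R⁻¹ • (x - c))) :
    ‖testL2 (lap ψ)‖ = R⁻¹ * R⁻¹ * √(R ^ d) * ‖testL2 (lap β)‖ := by
  have h' : ∀ x, ψ x = (1 : ℝ) * β (R⁻¹ • (x - c)) := fun x => by simp [h]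
  refine norm_testL2_of_scaling (c := c) (by positivity) hR fun x => ?_
  rw [lap_apply, lap_apply, Finset.mul_sum]
  refine Finset.sum_congr rfl fun i _ => ?_
  rw [pd_of_scaling (pd_of_scaling h' i) i, one_mul]

/-! ### The bump function and the geometry of the cone. -/

/-- A test function on `ℝᵈ` supported in the unit ball, with nonzero gradient. -/
theorem exists_test_unitBall (d : ℕ) [NeZero d] : ∃ β : 𝓓((⊤ : Opens (Rn d)), ℂ),
    tsupport β ⊆ Metric.closedBall 0 1 ∧ 0 < ‖testGrad β‖ := by
  let b : ContDiffBump (0 : Rn d) := ⟨1 / 2, 1, by norm_num, by norm_num⟩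
  have hs : tsupport (fun x => ((b x : ℝ) : ℂ)) ⊆ tsupport b :=
    tsupport_comp_subset (g := fun r : ℝ => (r : ℂ)) Complex.ofReal_zero b
  let β : 𝓓((⊤ : Opens (Rn d)), ℂ) :=
    ⟨fun x => ((b x : ℝ) : ℂ), Complex.ofRealCLM.contDiff.comp b.contDiff,
      b.hasCompactSupport.comp_left (g := fun r : ℝ => (r : ℂ)) Complex.ofReal_zero,
      fun _ _ => trivial⟩
  refine ⟨β, fun x hx => ?_, norm_pos_iff.2 fun h0 => ?_⟩
  · have := hs hx
    rw [b.tsupport_eq] at this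
    exact this
  -- A vanishing gradient would force `β = 0` by `sobolevZero_eq_zero`, whereas the bump equals one
  -- at the origin.
  · have h1 := testL2_mem_sobolevZero β
    rw [h0] at h1
    have h2 := norm_testL2_sq β
    rw [sobolevZero_eq_zero h1, norm_zero, zero_pow two_ne_zero] at h2
    have hc : Continuous fun x => ‖β x‖ ^ 2 := β.continuous.norm.pow 2
    have hcs : HasCompactSupport fun x => ‖β x‖ ^ 2 :=
      β.hasCompactSupport.comp_left (g := fun z : ℂ => ‖z‖ ^ 2) (by simp)
    have h3 : 0 < ∫ x, ‖β x‖ ^ 2 := by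
      refine hc.integral_pos_of_hasCompactSupport_nonneg_nonzero hcs (fun x => by positivity)
        (x := 0) ?_
      have : b 0 = 1 := b.one_of_mem_closedBall (by simp [b.rIn_pos.le])
      change ‖((b 0 : ℝ) : ℂ)‖ ^ 2 ≠ 0
      simp [this]
    linarith

/-- Translation and dilation of a test function supported in the unit ball. -/
theorem exists_test_scaling {d : ℕ} {Ω Ω' : Opens (Rn d)} {β : 𝓓(Ω', ℂ)}
    (hβ : tsupport β ⊆ Metric.closedBall 0 1) {R : ℝ} (hR : 0 < R) {c : Rn d}
    (hc : Metric.closedBall c R ⊆ Ω) : ∃ ψ : 𝓓(Ω, ℂ), (∀ x, ψ x = β (R⁻¹ • (x - c))) ∧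
      tsupport ψ ⊆ Metric.closedBall c R := by
  have hs : tsupport (fun x => β (R⁻¹ • (x - c))) ⊆ Metric.closedBall c R := by
    refine closure_minimal (fun x hx => ?_) Metric.isClosed_closedBall
    have := hβ (subset_tsupport _ hx)
    rw [mem_closedBall_zero_iff, norm_smul, norm_inv, Real.norm_of_nonneg hR.le,
      inv_mul_le_iff₀ hR, mul_one] at this
    rwa [mem_closedBall_iff_norm]
  have hd : ContDiff ℝ (⊤ : ℕ∞) fun x => β (R⁻¹ • (x - c)) :=
    β.contDiff.comp ((contDiff_id.sub contDiff_const).const_smul R⁻¹)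
  have hcs : HasCompactSupport fun x => β (R⁻¹ • (x - c)) :=
    (isCompact_closedBall c R).of_isClosed_subset (isClosed_tsupport _) hs
  exact ⟨⟨fun x => β (R⁻¹ • (x - c)), hd, hcs, hs.trans hc⟩, fun x => rfl, hs⟩

/-- The cone contains balls whose radii grow linearly with the distance to the origin. -/
theorem closedBall_subset_cone {d : ℕ} [NeZero d] {δ t : ℝ} (hδ : 0 < δ) (ht : 0 < t) :
    Metric.closedBall (EuclideanSpace.single 0 t : Rn d) (min δ 1 / 4 * t) ⊆
      cone d δ ∩ {x | t / 2 < ‖x‖} := by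
  intro x hx
  rw [mem_closedBall_iff_norm] at hx
  set y : Rn d := x - EuclideanSpace.single 0 t with hy
  -- The bound `t / 4` on the radius gives `x 0 ≥ 3t/4`, hence also `‖x‖ > t / 2`; the bound `δ t /
  -- 4` gives `|x'| ≤ δ t / 4 < δ x 0`.
  have m1 : min δ 1 / 4 * t ≤ t / 4 := by
    nlinarith [min_le_right δ 1]
  have m2 : min δ 1 / 4 * t ≤ δ * t / 4 := by
    nlinarith [min_le_left δ 1]
  have h0 : |x 0 - t| ≤ t / 4 := by
    have := (PiLp.norm_apply_le y 0).trans (hx.trans m1)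
    simpa [hy] using this
  have hx0 : 3 / 4 * t ≤ x 0 := by
    have := (abs_le.1 h0).1
    linarith
  have h1 : √(∑ i ∈ Finset.univ.erase 0, (x i) ^ 2) ≤ ‖y‖ := by
    rw [EuclideanSpace.norm_eq]
    refine Real.sqrt_le_sqrt ?_
    rw [← Finset.add_sum_erase _ _ (Finset.mem_univ 0)]
    refine le_add_of_nonneg_of_le (by positivity) (Finset.sum_le_sum fun i hi => ?_)
    have : y i = x i := by simp [hy, Finset.ne_of_mem_erase hi]
    simp [this]
  refine ⟨⟨by linarith, ?_⟩, ?_⟩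
  · have : δ * (3 / 4 * t) ≤ δ * x 0 := mul_le_mul_of_nonneg_left hx0 hδ.le
    nlinarith [mul_pos hδ ht]
  · have := (le_abs_self _).trans (PiLp.norm_apply_le x 0)
    simp only [Set.mem_ofPred_eq]
    linarith

/-! ### Construction of the singular sequence. -/

/-- Writing `q = √q * √q`, one factor is bounded by `√s` on the support and the other is absorbed in
the energy norm. Relative to that norm the potential term is small as soon as `s` is small, however
large the support. -/
theorem norm_schrodingerTest_le {d : ℕ} {Ω : Opens (Rn d)} {q : Rn d → ℝ}
    (hq1 : MemLpLoc q 1 Ω) (hq : MemLpLoc q 2 Ω) (φ : 𝓓(Ω, ℂ)) {s : ℝ}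
    (hs : ∀ᵐ x ∂(vol Ω), φ x ≠ 0 → 0 ≤ q x ∧ q x ≤ s) :
    ‖schrodingerTest hq φ‖ ≤ ‖testL2 (lap φ)‖ + √s * ‖testForm hq1 φ‖ := by
  have h1 : ‖(hq.memLp_mul_test φ).toLp _‖ ≤ √s * ‖(hq1.sqrt.memLp_mul_test φ).toLp _‖ := by
    refine Lp.norm_le_mul_norm_of_ae_le_mul ?_
    filter_upwards [(hq.memLp_mul_test φ).coeFn_toLp, (hq1.sqrt.memLp_mul_test φ).coeFn_toLp, hs]
      with x hx hx' hxs
    rw [hx, hx']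
    by_cases h0 : φ x = 0
    · simp [h0]
    · obtain ⟨q0, qs⟩ := hxs h0
      rw [norm_mul, norm_mul, ← mul_assoc, Complex.norm_real, Complex.norm_real,
        Real.norm_of_nonneg q0, Real.norm_of_nonneg (Real.sqrt_nonneg _)]
      refine mul_le_mul_of_nonneg_right ?_ (norm_nonneg _)
      calc q x = √(q x) * √(q x) := (Real.mul_self_sqrt q0).symm
        _ ≤ √s * √(q x) := mul_le_mul_of_nonneg_right (Real.sqrt_le_sqrt qs) (Real.sqrt_nonneg _)
  have h2 : ‖(hq1.sqrt.memLp_mul_test φ).toLp _‖ ≤ ‖testForm hq1 φ‖ := by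
    rw [← sq_le_sq₀ (norm_nonneg _) (norm_nonneg _), norm_sq_testForm]
    exact le_add_of_nonneg_left (sq_nonneg _)
  calc _ ≤ ‖-testL2 (lap φ)‖ + ‖(hq.memLp_mul_test φ).toLp _‖ := norm_add_le _ _
    _ ≤ _ := by
      rw [norm_neg]
      exact add_le_add_right (h1.trans (mul_le_mul_of_nonneg_left h2 (Real.sqrt_nonneg _))) _

/-- Normalized test functions far away in the cone on which `-Δ + q` is small. -/
theorem exists_test_far {d : ℕ} [NeZero d] {Ω : Opens (Rn d)} {q : Rn d → ℝ}
    (hq1 : MemLpLoc q 1 Ω) (hq : MemLpLoc q 2 Ω) (q0 : ∀ᵐ x ∂(vol Ω), 0 ≤ q x)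
    {δ : ℝ} (hδ : 0 < δ) (hcone : cone d δ ⊆ Ω)
    (hdecay : Tendsto (fun k : ℝ => essSup (fun x => (q x : EReal))
      (volume.restrict (cone d δ ∩ {x | k < ‖x‖}))) atTop (𝓝 0))
    {ε : ℝ} (hε : 0 < ε) (r : ℝ) : ∃ φ : 𝓓(Ω, ℂ), (∀ x ∈ tsupport φ, r < ‖x‖) ∧
      ‖testForm hq1 φ‖ = 1 ∧ ‖schrodingerTest hq φ‖ ≤ ε := by
  obtain ⟨β, hβ, hβ0⟩ := exists_test_unitBall d
  set m : ℝ := min δ 1 / 4 with hm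
  have m0 : 0 < m := by have := lt_min hδ one_pos; positivity
  -- The bound `q ≤ (ε / 2) ^ 2` enters through its square root, so the potential contributes `ε /
  -- 2`; the other half is left for the Laplacian.
  have hs : (0 : EReal) < (((ε / 2) ^ 2 : ℝ) : EReal) := EReal.coe_pos.2 (by positivity)
  have hd2 := (hdecay.eventually (gt_mem_nhds hs))
  have hmul : Tendsto (fun k : ℝ => m * (2 * k)) atTop atTop :=
    (tendsto_id.const_mul_atTop two_pos).const_mul_atTop m0
  have hinv : Tendsto (fun k : ℝ => (m * (2 * k))⁻¹ * (‖testL2 (lap β)‖ / ‖testGrad β‖)) atTop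
      (𝓝 0) := by
    simpa using (tendsto_inv_atTop_zero.comp hmul).mul_const (‖testL2 (lap β)‖ / ‖testGrad β‖)
  -- The ball is centred at distance `2 * k` on the axis, so by `closedBall_subset_cone` it lies in
  -- `‖x‖ > k`, where `q` is small, while its radius `m * (2 * k)` still grows with `k`.
  obtain ⟨k, hk1, hk2, hkr, hk0⟩ := (hd2.and ((hinv.eventually (gt_mem_nhds (half_pos hε))).and
    ((eventually_ge_atTop r).and (eventually_gt_atTop 0)))).exists
  have t0 : 0 < 2 * k := by linarith
  set R : ℝ := m * (2 * k) with hR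
  have R0 : 0 < R := mul_pos m0 t0
  have hball := closedBall_subset_cone (d := d) hδ t0
  rw [← hm, ← hR, mul_div_cancel_left₀ k two_ne_zero] at hball
  obtain ⟨ψ, hψ, hψs⟩ := exists_test_scaling hβ R0
    ((hball.trans Set.inter_subset_left).trans hcone)
  have hgrad := norm_testGrad_of_scaling R0 hψ
  have hlap := norm_testL2_lap_of_scaling R0 hψ
  have hg0 : 0 < ‖testGrad ψ‖ := by
    rw [hgrad]
    positivity
  have hle : ‖testGrad ψ‖ ≤ ‖testForm hq1 ψ‖ := by
    rw [← sq_le_sq₀ (norm_nonneg _) (norm_nonneg _), norm_sq_testForm]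
    exact le_add_of_nonneg_right (sq_nonneg _)
  have hN : 0 < ‖testForm hq1 ψ‖ := hg0.trans_le hle
  have hlap' : ‖testL2 (lap ψ)‖ ≤ ε / 2 * ‖testForm hq1 ψ‖ := by
    refine le_trans ?_ (mul_le_mul_of_nonneg_left hle (half_pos hε).le)
    -- The volume factors `√(R ^ d)` cancel in the quotient, leaving one power of `R⁻¹`.
    have : ‖testL2 (lap ψ)‖ = R⁻¹ * (‖testL2 (lap β)‖ / ‖testGrad β‖) * ‖testGrad ψ‖ := by
      rw [hgrad, hlap]
      field_simp
    rw [this]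
    exact mul_le_mul_of_nonneg_right hk2.le hg0.le
  have hqs : ∀ᵐ x ∂(vol Ω), ψ x ≠ 0 → 0 ≤ q x ∧ q x ≤ (ε / 2) ^ 2 := by
    have hms : MeasurableSet (Metric.closedBall (EuclideanSpace.single 0 (2 * k) : Rn d) R) :=
      Metric.isClosed_closedBall.measurableSet
    have h1 := ae_restrict_of_ae_restrict_of_subset hball (ae_lt_of_essSup_lt hk1)
    rw [ae_restrict_iff' hms] at h1
    filter_upwards [q0, ae_restrict_of_ae h1] with x hx hx' hne
    exact ⟨hx, (EReal.coe_lt_coe_iff.1 (hx' (hψs (subset_tsupport _ hne)))).le⟩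
  have hS := norm_schrodingerTest_le hq1 hq ψ hqs
  rw [Real.sqrt_sq (by positivity)] at hS
  have hc : ‖((‖testForm hq1 ψ‖⁻¹ : ℝ) : ℂ)‖ = ‖testForm hq1 ψ‖⁻¹ := by
    rw [Complex.norm_real, norm_inv, norm_norm]
  refine ⟨((‖testForm hq1 ψ‖⁻¹ : ℝ) : ℂ) • ψ, fun x hx => ?_, ?_, ?_⟩
  · have h1 : x ∈ tsupport ψ := by
      refine closure_mono (fun y hy => ?_) hx
      exact right_ne_zero_of_mul (a := ((‖testForm hq1 ψ‖⁻¹ : ℝ) : ℂ)) hy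
    exact hkr.trans_lt (hball (hψs h1)).2
  · rw [testForm_smul, norm_smul, hc, inv_mul_cancel₀ hN.ne']
  · rw [schrodingerTest_smul, norm_smul, hc, inv_mul_le_iff₀ hN]
    linarith

/-- Normalized test functions whose supports move to infinity converge weakly to zero in the form
space. -/
theorem tendsto_inner_testForm {d : ℕ} {Ω : Opens (Rn d)} {q : Rn d → ℝ} (hq : MemLpLoc q 1 Ω)
    {φ : ℕ → 𝓓(Ω, ℂ)} (hφ : ∀ n, ‖testForm hq (φ n)‖ = 1)
    (hs : ∀ r : ℝ, ∀ᶠ n in atTop, ∀ x ∈ tsupport (φ n), r < ‖x‖) (w : FormSpace Ω q) :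
    Tendsto (fun n => inner ℂ w (testForm hq (φ n))) atTop (𝓝 0) := by
  -- The inner product of the form space splits into the `d` gradient components and the `√q`
  -- component; each is bounded by one and has escaping support.
  have h1 : ∀ i, Tendsto (fun n => inner ℂ ((w : WithLp 2 (L2Vec Ω × L2 Ω)).fst i)
      (testL2 (pd i (φ n)))) atTop (𝓝 0) := by
    intro i
    refine tendsto_inner_of_support (C := 1) (fun n => ?_) (fun r => ?_) _
    · refine (PiLp.norm_apply_le (testGrad (φ n)) i).trans ?_
      rw [← hφ n, ← sq_le_sq₀ (norm_nonneg _) (norm_nonneg _), norm_sq_testForm]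
      exact le_add_of_nonneg_right (sq_nonneg _)
    · filter_upwards [hs r] with n hn
      filter_upwards [coeFn_testL2 (pd i (φ n))] with x hx hxr
      rw [hx]
      exact image_eq_zero_of_notMem_tsupport
        fun h => (hn x (tsupport_pd_subset i _ h)).not_ge hxr
  have h2 : Tendsto (fun n => inner ℂ (w : WithLp 2 (L2Vec Ω × L2 Ω)).snd
      ((hq.sqrt.memLp_mul_test (φ n)).toLp _)) atTop (𝓝 0) := by
    refine tendsto_inner_of_support (C := 1) (fun n => ?_) (fun r => ?_) _
    · rw [← hφ n, ← sq_le_sq₀ (norm_nonneg _) (norm_nonneg _), norm_sq_testForm]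
      exact le_add_of_nonneg_left (sq_nonneg _)
    · filter_upwards [hs r] with n hn
      filter_upwards [(hq.sqrt.memLp_mul_test (φ n)).coeFn_toLp] with x hx hxr
      rw [hx, image_eq_zero_of_notMem_tsupport (f := φ n) fun h => (hn x h).not_ge hxr, mul_zero]
  have h3 := (tendsto_finsetSum Finset.univ fun i _ => h1 i).add h2
  simp only [Finset.sum_const_zero, add_zero] at h3
  exact h3

end DampedWave

end

/-! ### The essential spectrum contains zero. -/

theorem mainTheorem8 {d : ℕ} [NeZero d] (Ω : TopologicalSpace.Opens (DampedWave.Rn d))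
    (a q : DampedWave.Rn d → ℝ)
    (haq : DampedWave.Regularity Ω a q) (hq : DampedWave.MemLpLoc q 2 Ω)
    (δ : ℝ) (hδ : 0 < δ) (hcone : DampedWave.cone d δ ⊆ Ω)
    (hdecay : Tendsto
      (fun k : ℝ => essSup (fun x => (q x : EReal))
        (volume.restrict (DampedWave.cone d δ ∩ {x | k < ‖x‖})))
      atTop (𝓝 0)) :
    (0 : ℂ) ∈ DampedWave.essentialSpectrum2 (H := DampedWave.StateSpace Ω q) (DampedWave.generator Ω a q) ∧
    ∃ (φ : ℕ → 𝓓(Ω, ℂ)) (Φ : ℕ → (DampedWave.generator Ω a q).domain),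
      DampedWave.IsSingularSequence (H := DampedWave.StateSpace Ω q) (DampedWave.generator Ω a q) 0 Φ ∧
      (∀ n, DampedWave.Represents Ω q (DampedWave.testL2 (φ n))
          (Φ n : DampedWave.StateSpace Ω q).fst ∧
        (Φ n : DampedWave.StateSpace Ω q).snd = 0) ∧
      (∀ r : ℝ, ∀ᶠ n in atTop, ∀ x ∈ tsupport (φ n), r < ‖x‖) := by
  have hq1 := haq.q_loc
  -- The choices are `ε = 1 / (n + 1)` and `r = n`: smallness of `(-Δ + q) φₙ` and escape of the
  -- supports are achieved together.
  choose φ hsupp hnorm hS using fun n : ℕ => DampedWave.exists_test_far hq1 hq haq.q_nonneg hδ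
    hcone hdecay (Nat.one_div_pos_of_nat (α := ℝ) (n := n)) n
  choose Φ hΦ hGΦ using fun n => DampedWave.mem_generator_of_test haq.a_loc hq1 hq (φ n)
  have hfar : ∀ r : ℝ, ∀ᶠ n in atTop, ∀ x ∈ tsupport (φ n), r < ‖x‖ := fun r => by
    filter_upwards [tendsto_natCast_atTop_atTop.eventually_ge_atTop r] with n hn x hx
    exact hn.trans_lt (hsupp n x hx)
  have hsing : DampedWave.IsSingularSequence (H := DampedWave.StateSpace Ω q)
      (DampedWave.generator Ω a q) 0 Φ := by
    refine ⟨fun n => ?_, fun w => ?_, ?_⟩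
    · rw [hΦ, ← sq_eq_sq₀ (norm_nonneg _) zero_le_one, WithLp.prod_norm_sq_eq_of_L2]
      simp [hnorm]
    · refine (DampedWave.tendsto_inner_testForm hq1 hnorm hfar w.fst).congr fun n => ?_
      rw [hΦ, WithLp.prod_inner_apply]
      simp
    · rw [tendsto_zero_iff_norm_tendsto_zero]
      refine squeeze_zero (fun n => norm_nonneg _) (fun n => ?_)
        (tendsto_one_div_add_atTop_nhds_zero_nat (𝕜 := ℝ))
      rw [zero_smul, sub_zero, hGΦ]
      refine le_trans (le_of_eq ?_) (hS n)
      rw [← sq_eq_sq₀ (norm_nonneg _) (norm_nonneg _), WithLp.prod_norm_sq_eq_of_L2]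
      simp
  refine ⟨⟨Φ, hsing⟩, φ, Φ, hsing, fun n => ?_, hfar⟩
  rw [hΦ]
  exact ⟨DampedWave.represents_testForm hq1 (φ n), rfl⟩
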